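/- Let $d,M\ge 1$ be integers and $\theta,\varphi,\chi\in\mathbb{R}$. Put $$U=\begin{pmatrix} e^{-i\varphi}\cos\theta & -ie^{i\chi}\sin\theta\\ -ie^{-i\chi}\sin\theta & e^{i\varphi}\cos\theta\end{pmatrix},\qquad Z=\begin{pmatrix}1&0\\0&-1\end{pmatrix},\qquad \mathcal U(\omega)=\left(e^{i\omega Z}U\right)^d,$$ $$p_X(\omega)=\left|\langle 0|\,\mathcal U(\omega)\,\tfrac{|0\rangle+|1\rangle}{\sqrt2}\right|^2,\qquad p_Y(\omega)=\left|\langle 0|\,\mathcal U(\omega)\,\tfrac{|0\rangle+i|1\rangle}{\sqrt2}\right|^2,$$ and let $\mathfrak h(\omega)=p_X(\omega)-\tfrac12+i\left(p_Y(\omega)-\tfrac12\right)$, with Fourier coefficients $c_k=\frac1\pi\int_0^\pi \mathfrak h(\omega)e^{-2ik\omega}\,d\omega$. For $\omega_j=\frac{j\pi}{2d-1}$, $j=0,\dots,2d-2$, let $p_X^{\mathrm{exp}}(\omega_j)$ and $p_Y^{\mathrm{exp}}(\omega_j)$ be the empirical frequencies of success in $M$ Bernoulli trials with success probabilities $p_X(\omega_j)$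 and $p_Y(\omega_j)$, respectively, all the $2(2d-1)M$ trials being independent. Put $\mathfrak h^{\mathrm{exp}}_j=p_X^{\mathrm{exp}}(\omega_j)-\frac12+i\left(p_Y^{\mathrm{exp}}(\omega_j)-\frac12\right)$, $$c_k^{\mathrm{exp}}=\frac1{2d-1}\sum_{j=0}^{2d-2}e^{-2\pi i jk/(2d-1)}\,\mathfrak h_j^{\mathrm{exp}},\qquad v_k=c_k^{\mathrm{exp}}-c_k .$$ If $d^{5/4}|\theta|<1$ (in particular, in the regime $d^{5/4}|\theta|\ll 1$), then for every $k=0,1,\dots,d-1$ one has $0<\mathbb E|v_k|^2<\infty$ and $$\mathrm{SNR}_k:=\frac{|c_k|^2}{\mathbb E|v_k|^2}\ \ge\ 2(2d-1)M\sin^2\theta\left(1-\frac43(d\theta)^2\left(1+3d^3\theta^2\right)\right).$$ -/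

import Mathlib

open MeasureTheory ProbabilityTheory
open scoped Matrix

noncomputable section

namespace QSPC

/-- The fermionic simulation gate with swap angle `θ` and phases `φ`, `χ`, restricted to the
single-excitation subspace with ordered basis `|0_ℓ⟩ = |01⟩`, `|1_ℓ⟩ = |10⟩`. -/
def fsimGate (θ φ χ : ℝ) : Matrix (Fin 2) (Fin 2) ℂ :=
  !![Complex.exp (-(Complex.I * φ)) * (Real.cos θ : ℂ),
      -Complex.I * Complex.exp (Complex.I * χ) * (Real.sin θ : ℂ);
     -Complex.I * Complex.exp (-(Complex.I * χ)) * (Real.sin θ : ℂ),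
      Complex.exp (Complex.I * φ) * (Real.cos θ : ℂ)]

/-- The tunable phase rotation `e^{iωZ}`. -/
def zRotation (ω : ℝ) : Matrix (Fin 2) (Fin 2) ℂ :=
  !![Complex.exp (Complex.I * ω), 0; 0, Complex.exp (-(Complex.I * ω))]

/-- The periodic circuit: `d` repetitions of the gate followed by the phase rotation. -/
def circuit (d : ℕ) (θ φ χ ω : ℝ) : Matrix (Fin 2) (Fin 2) ℂ :=
  (zRotation ω * fsimGate θ φ χ) ^ d

/-- The two types of experiment, which differ in the Bell state that is prepared. -/
inductive Experiment
  | X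
  | Y

/-- The input Bell state: `(|0_ℓ⟩ + |1_ℓ⟩)/√2` for type `X`, `(|0_ℓ⟩ + i|1_ℓ⟩)/√2` for type `Y`. -/
def bellState : Experiment → (Fin 2 → ℂ)
  | .X => ![1 / (Real.sqrt 2 : ℂ), 1 / (Real.sqrt 2 : ℂ)]
  | .Y => ![1 / (Real.sqrt 2 : ℂ), Complex.I / (Real.sqrt 2 : ℂ)]

/-- The exact probability of measuring `|0_ℓ⟩` at the output of the circuit:
`p_X(ω; θ, φ, χ)` and `p_Y(ω; θ, φ, χ)`. -/
def prob (e : Experiment) (d : ℕ) (θ φ χ ω : ℝ) : ℝ :=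
  ‖(circuit d θ φ χ ω *ᵥ bellState e) 0‖ ^ 2

/-- The function `h = p_X - 1/2 + i (p_Y - 1/2)` reconstructed from the exact probabilities. -/
def reconstructed (d : ℕ) (θ φ χ ω : ℝ) : ℂ :=
  ((prob .X d θ φ χ ω - 1 / 2 : ℝ) : ℂ) + Complex.I * ((prob .Y d θ φ χ ω - 1 / 2 : ℝ) : ℂ)

/-- The coefficient of `e^{2ikω}` in the Fourier series of the `π`-periodic function `h`. -/
def fourierCoefficient (d : ℕ) (θ φ χ : ℝ) (k : ℤ) : ℂ :=
  (1 / (Real.pi : ℂ)) * ∫ ω in (0 : ℝ)..Real.pi,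
    reconstructed d θ φ χ ω * Complex.exp (-(2 * Complex.I * (k : ℂ) * (ω : ℂ)))

/-- The sampling angles `ω_j = jπ/(2d-1)`, `j = 0, …, 2d-2`. -/
def samplingAngle (d : ℕ) (j : Fin (2 * d - 1)) : ℝ :=
  (j : ℝ) * Real.pi / (2 * (d : ℝ) - 1)

/-- A label of a single measurement: type of experiment, sampling angle, repetition. -/
abbrev Shot (d M : ℕ) : Type := Experiment × Fin (2 * d - 1) × Fin M

/-- The measurement outcomes of all the experiments, each repeated `M` times: independent random
bits, where a measurement of type `e` at the angle `ω_j` gives the outcome `0` (that is, `|0_ℓ⟩`)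
with the exact probability of the circuit. -/
structure IsMeasurementRecord {Ω : Type*} [MeasurableSpace Ω] (P : Measure Ω)
    (d M : ℕ) (θ φ χ : ℝ) (b : Shot d M → Ω → Fin 2) : Prop where
  measurable : ∀ s, Measurable (b s)
  indep : iIndepFun b P
  prob_zero : ∀ (e : Experiment) (j : Fin (2 * d - 1)) (i : Fin M),
    P.real {w | b (e, j, i) w = 0} = prob e d θ φ χ (samplingAngle d j)

/-- The experimental probability: the fraction `(1/M) ∑ (1 - b_i)` of outcomes `0`. -/
def probExp {Ω : Type*} {d M : ℕ} (b : Shot d M → Ω → Fin 2) (e : Experiment)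
    (j : Fin (2 * d - 1)) (w : Ω) : ℝ :=
  (1 / (M : ℝ)) * ∑ i : Fin M, (1 - ((b (e, j, i) w : ℕ) : ℝ))

/-- The experimental data vector `h_j^exp`. -/
def reconstructedExp {Ω : Type*} {d M : ℕ} (b : Shot d M → Ω → Fin 2)
    (j : Fin (2 * d - 1)) (w : Ω) : ℂ :=
  ((probExp b .X j w - 1 / 2 : ℝ) : ℂ) + Complex.I * ((probExp b .Y j w - 1 / 2 : ℝ) : ℂ)

/-- The experimental Fourier coefficient: the normalized discrete Fourier transform
`(1/(2d-1)) ∑_j e^{-2πijk/(2d-1)} h_j^exp` of the data vector. -/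
def fourierCoefficientExp {Ω : Type*} {d M : ℕ} (b : Shot d M → Ω → Fin 2) (k : ℤ) (w : Ω) : ℂ :=
  (1 / (2 * (d : ℂ) - 1)) * ∑ j : Fin (2 * d - 1),
    Complex.exp (-(2 * Real.pi * Complex.I * ((j : ℕ) : ℂ) * (k : ℂ) / (2 * (d : ℂ) - 1))) *
      reconstructedExp b j w

/-- The additive sampling error `v_k = c_k^exp - c_k(θ, φ, χ)`. -/
def samplingError {Ω : Type*} {d M : ℕ} (θ φ χ : ℝ) (b : Shot d M → Ω → Fin 2) (k : ℤ)
    (w : Ω) : ℂ :=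
  fourierCoefficientExp b k w - fourierCoefficient d θ φ χ k

/-- The signal-to-noise ratio `|c_k|² / E|v_k|²` of the `k`-th Fourier coefficient. -/
def SNR {Ω : Type*} [MeasurableSpace Ω] (P : Measure Ω) {d M : ℕ} (θ φ χ : ℝ)
    (b : Shot d M → Ω → Fin 2) (k : ℤ) : ℝ :=
  ‖fourierCoefficient d θ φ χ k‖ ^ 2 / ∫ w, ‖samplingError θ φ χ b k w‖ ^ 2 ∂P

end QSPC

end

/-!
Writing `t = tan θ`, `y = t²` and `z = e^{2i(ω-φ)}`, the first row of the circuit is, up to phases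
and the factor `cosᵈ θ`, equal to `(p_d(z), -i t z r_d(z))` for real polynomials given by the
recursion `p ↦ z (p - y r)`, `r ↦ p + r` (`rowPoly`, `circuit_row_zero`). By unitarity the
reconstructed function `h` is the first entry of that row times the conjugate of the second, and
since `r_d` is self-reciprocal (`pow_mul_conj_aeval_rowPoly`) `h` is a trigonometric polynomial in
`e^{2iω}` with frequencies between `-(d-1)` and `d-1`, whose coefficients have modulus
`|sin θ| cos^(2d-1) θ |[z^(k+d)] p_d r_d|` (`reconstructed_eq_sum`). Hence `2d-1` samples determine
the coefficients without aliasing (`sum_exp_mul_reconstructed`), and `v_k` is a linear combination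
of centered independent bits.

*Noise.* Each of the `2(2d-1)M` weights in `v_k` has modulus `1/((2d-1)M)` and each bit has variance
`p(1-p) ≤ 1/4`, so `E|v_k|² ≤ 1/(2(2d-1)M)`. It is positive because `|h| ≤ 1/2` prevents the two
experiments at one angle from both being deterministic (`samplingError_secondMoment`).

*Signal.* To first order in `y` the coefficient of `z^(k+d)` in `p_d r_d` is
`1 - y (d-1-k)(d+3k)/2`, with an error of at most `y² d⁴` (`abs_signalPoly_coeff_sub_le`). Together
with the loss `(2d-1) θ²` from `cos^(4d-2) θ`, the total loss of `|c_k|²/sin² θ` in first order is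
`((2d-1) + (d-1-k)(d+3k)) θ² ≤ (4/3 d² - 1/4) θ²`, and the higher orders fit into the term
`4 d⁵ θ⁴` (`norm_sq_fourierCoefficient_ge`).
-/

namespace QSPC

open Polynomial

/-! ### The polynomials of the periodic circuit -/

/-- The pair `(p_n, r_n)` of real polynomials describing the first row of the `n`-th power of the
circuit's building block: with `t = tan θ`, `y = t²` and `z = e^{2i(ω-φ)}` this row is
`cosⁿθ e^{-in(ω-φ)} (p_n(z), -i t e^{i(φ+χ)} z r_n(z))`. -/
noncomputable def rowPoly (y : ℝ) : ℕ → ℝ[X] × ℝ[X]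
  | 0 => (1, 0)
  | n + 1 => (X * ((rowPoly y n).1 - C y * (rowPoly y n).2), (rowPoly y n).1 + (rowPoly y n).2)

/-- The product `p_n r_n`; up to a factor of constant modulus and a shift by `n`, its coefficients
are the Fourier coefficients of the reconstructed function. -/
noncomputable def signalPoly (y : ℝ) (n : ℕ) : ℝ[X] := (rowPoly y n).1 * (rowPoly y n).2

theorem natDegree_rowPoly (y : ℝ) (n : ℕ) :
    (rowPoly y n).1.natDegree ≤ n ∧ (rowPoly y n).2.natDegree ≤ n - 1 := by
  induction n with
  | zero => simp [rowPoly]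
  | succ n ih =>
    obtain ⟨h1, h2⟩ := ih
    constructor
    · have h3 : ((rowPoly y n).1 - C y * (rowPoly y n).2).natDegree ≤ n := by
        refine (natDegree_sub_le _ _).trans (max_le h1 ?_)
        exact (natDegree_C_mul_le _ _).trans (by omega)
      refine (natDegree_mul_le).trans ?_
      have := natDegree_X_le (R := ℝ)
      omega
    · refine (natDegree_add_le _ _).trans (max_le ?_ ?_) <;> omega

theorem natDegree_signalPoly_lt (y : ℝ) {n : ℕ} (hn : 1 ≤ n) :
    (signalPoly y n).natDegree < 2 * n := by
  have h := natDegree_rowPoly y n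
  have := natDegree_mul_le (p := (rowPoly y n).1) (q := (rowPoly y n).2)
  unfold signalPoly
  omega

theorem signalPoly_coeff_zero (y : ℝ) {n : ℕ} (hn : 1 ≤ n) : (signalPoly y n).coeff 0 = 0 := by
  obtain ⟨m, rfl⟩ := Nat.exists_eq_add_of_le' hn
  simp [signalPoly, rowPoly, mul_assoc]

/-- On the unit circle `r_n` is self-reciprocal. -/
theorem pow_mul_conj_aeval_rowPoly (y : ℝ) {z : ℂ} (hz : z * (starRingEnd ℂ) z = 1) (n : ℕ) :
    z ^ n * (starRingEnd ℂ) (aeval z (rowPoly y n).2) = z * aeval z (rowPoly y n).2 := by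
  have key : ∀ n, aeval z (rowPoly y (n + 2)).2 = (1 + z) * aeval z (rowPoly y (n + 1)).2
      - z * (1 + y) * aeval z (rowPoly y n).2 := by
    intro n
    simp only [rowPoly, map_add, map_mul, map_sub, aeval_X, aeval_C, Complex.coe_algebraMap]
    ring
  induction n using Nat.twoStepInduction with
  | zero => simp [rowPoly]
  | one => simp [rowPoly]
  | more n h0 h1 =>
    rw [key]
    simp only [map_add, map_mul, map_sub, map_one, Complex.conj_ofReal]
    linear_combination (1 + z) * h1 - z * (1 + y) * h0 + (z ^ (n + 1)
      * (starRingEnd ℂ) (aeval z (rowPoly y (n + 1)).2)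
      - (1 + y) * z ^ (n + 1) * (starRingEnd ℂ) (aeval z (rowPoly y n).2)) * hz

/-! ### Expansion of the coefficients to first order in `tan² θ` -/

theorem abs_ite_mul_sub_le (n j : ℕ) :
    |(if j < n then (j : ℝ) * ((n : ℝ) - 1 - j) else 0)| ≤ (n : ℝ) ^ 2 / 4 := by
  split_ifs with h
  · have h2 : (j : ℝ) + 1 ≤ n := by exact_mod_cast h
    have h3 : (0 : ℝ) ≤ j := Nat.cast_nonneg j
    rw [abs_of_nonneg (mul_nonneg h3 (by linarith))]
    nlinarith [sq_nonneg ((n : ℝ) - 2 * j)]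
  · simp only [abs_zero]
    positivity

/-- Expansion of the coefficients of `p_n` and `r_n` to first order in `y`, with a uniform bound for
the second-order remainders. -/
theorem rowPoly_coeff_expansion {y : ℝ} (hy : 0 ≤ y) (n : ℕ) (hyn : y * (n : ℝ) ^ 2 ≤ 1) :
    ∃ e f : ℕ → ℝ,
      (∀ j, (rowPoly y n).1.coeff j =
        (if j = n then 1 else 0) - y * (if j < n then (j : ℝ) else 0) + y ^ 2 * e j) ∧
      (∀ j, (rowPoly y n).2.coeff j = (if j < n then 1 else 0)
        - y * (if j < n then (j : ℝ) * ((n : ℝ) - 1 - j) else 0) + y ^ 2 * f j) ∧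
      (∀ j, |e j| ≤ (n : ℝ) ^ 3 / 10) ∧ (∀ j, |f j| ≤ (n : ℝ) ^ 4 / 40) := by
  induction n with
  | zero =>
    refine ⟨0, 0, fun j => ?_, fun j => ?_, fun j => ?_, fun j => ?_⟩ <;>
      simp [rowPoly, coeff_one]
  | succ n ih =>
    have hn0 : (0 : ℝ) ≤ n := Nat.cast_nonneg n
    push_cast at hyn
    have hyn' : y * (n : ℝ) ^ 2 ≤ 1 := by nlinarith
    obtain ⟨e, f, he, hf, hbe, hbf⟩ := ih hyn'
    refine ⟨fun j => match j with
      | 0 => 0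
      | i + 1 => e i + (if i < n then (i : ℝ) * ((n : ℝ) - 1 - i) else 0) - y * f i,
      fun j => e j + f j, ?_, ?_, ?_, ?_⟩
    · rintro (_ | j)
      · simp [rowPoly]
      · simp only [rowPoly, coeff_X_mul, coeff_sub, coeff_C_mul, he, hf]
        by_cases h : j < n
        · have h' : j ≠ n := by omega
          simp only [h, h', add_lt_add_iff_right, add_left_inj, if_true, if_false]
          push_cast
          ring
        · simp only [h, add_lt_add_iff_right, add_left_inj, if_false]
          ring
    · intro j
      simp only [rowPoly, coeff_add, he, hf]
      rcases lt_trichotomy j n with h | h | h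
      · have h' : j ≠ n := by omega
        have h'' : j < n + 1 := by omega
        simp only [h, h', h'', if_true, if_false]
        push_cast
        ring
      · subst h
        simp
        ring
      · have h1 : ¬ j < n := by omega
        have h' : j ≠ n := by omega
        have h'' : ¬ j < n + 1 := by omega
        simp only [h1, h', h'', if_false]
        ring
    · rintro (_ | j)
      · simp only [abs_zero]
        positivity
      · have hb := abs_ite_mul_sub_le n j
        have hyf : |y * f j| ≤ (n : ℝ) ^ 2 / 40 := by
          rw [abs_mul, abs_of_nonneg hy]
          calc y * |f j| ≤ y * ((n : ℝ) ^ 4 / 40) := mul_le_mul_of_nonneg_left (hbf j) hy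
            _ = (y * (n : ℝ) ^ 2) * ((n : ℝ) ^ 2 / 40) := by ring
            _ ≤ 1 * ((n : ℝ) ^ 2 / 40) := by gcongr
            _ = _ := one_mul _
        have h1 := abs_le.1 (hbe j)
        have h2 := abs_le.1 hb
        have h3 := abs_le.1 hyf
        push_cast
        rw [abs_le]
        constructor <;> nlinarith
    · intro j
      have h1 := abs_le.1 (hbe j)
      have h2 := abs_le.1 (hbf j)
      push_cast
      have h4 : (n : ℝ) ^ 3 / 10 + (n : ℝ) ^ 4 / 40 ≤ ((n : ℝ) + 1) ^ 4 / 40 := by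
        nlinarith [pow_nonneg hn0 2]
      rw [abs_le]
      constructor <;> linarith

/-- The sum of the integers strictly between `k` and `d`, written as a convolution. -/
theorem sum_range_ite_Ioo (k d : ℕ) (hk : k < d) :
    ∑ i ∈ Finset.range (k + d + 1),
      (if i < d then (i : ℝ) else 0) * (if k + d - i < d then 1 else 0)
      = ((d : ℝ) - 1 - k) * (d + k) / 2 := by
  obtain ⟨m, rfl⟩ := Nat.exists_eq_add_of_lt hk
  have h1 : ∀ m : ℕ, ∑ i ∈ Finset.Ico (k + 1) (k + 1 + m), (i : ℝ)
      = (m : ℝ) * (2 * k + 1 + m) / 2 := by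
    intro m
    induction m with
    | zero => simp
    | succ m ih =>
      rw [← add_assoc, Finset.sum_Ico_succ_top (by omega), ih]
      push_cast
      ring
  have h2 : ∑ i ∈ Finset.range (k + (k + m + 1) + 1),
      (if i < k + m + 1 then (i : ℝ) else 0) * (if k + (k + m + 1) - i < k + m + 1 then 1 else 0)
      = ∑ i ∈ Finset.Ico (k + 1) (k + 1 + m), (i : ℝ) := by
    symm
    refine Finset.sum_subset_zero_on_sdiff ?_ ?_ ?_
    · intro i hi
      simp only [Finset.mem_Ico, Finset.mem_range] at *
      omega
    · intro i hi
      simp only [Finset.mem_Ico, Finset.mem_range, Finset.mem_sdiff] at hi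
      by_cases h : i < k + m + 1
      · have : ¬ (k + (k + m + 1) - i < k + m + 1) := by omega
        simp [this]
      · simp [h]
    · intro i hi
      simp only [Finset.mem_Ico] at hi
      rw [if_pos (by omega), if_pos (by omega), mul_one]
  rw [h2, h1]
  push_cast
  ring

/-- The coefficient of `p_d r_d` belonging to the frequency `k` is `1 - y (d-1-k)(d+3k)/2` up to an
error of second order in `y`. -/
theorem abs_signalPoly_coeff_sub_le {y : ℝ} (hy : 0 ≤ y) {d k : ℕ} (hk : k < d)
    (hyd : y * (d : ℝ) ^ 2 ≤ 1) :
    |(signalPoly y d).coeff (k + d) - (1 - y * (((d : ℝ) - 1 - k) * (d + 3 * k) / 2))|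
      ≤ y ^ 2 * (d : ℝ) ^ 4 := by
  obtain ⟨e, f, he, hf, hbe, hbf⟩ := rowPoly_coeff_expansion hy d hyd
  have hd0 : (0 : ℝ) ≤ d := Nat.cast_nonneg d
  set a : ℕ → ℝ := fun j => if j < d then (j : ℝ) else 0 with ha
  set g : ℕ → ℝ := fun j => if j < d then 1 else 0 with hg
  set b : ℕ → ℝ := fun j => if j < d then (j : ℝ) * ((d : ℝ) - 1 - j) else 0 with hb
  set δ : ℕ → ℝ := fun j => if j = d then 1 else 0 with hδ
  have hba : ∀ j, |a j| ≤ d := by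
    intro j
    simp only [ha]
    split_ifs with h
    · rw [abs_of_nonneg (Nat.cast_nonneg j)]
      exact_mod_cast h.le
    · simp
  have hbg : ∀ j, |g j| ≤ 1 := by
    intro j
    simp only [hg]
    split_ifs <;> simp
  have hbb : ∀ j, |b j| ≤ (d : ℝ) ^ 2 / 4 := abs_ite_mul_sub_le d
  -- The terms of order `y²` and higher in the product, divided by `y²`, without the convolution
  -- of `δ` with `f`.
  set ρ : ℕ → ℝ := fun i => a i * b (k + d - i) + e i * g (k + d - i)
    - y * (a i * f (k + d - i) + e i * b (k + d - i)) + y ^ 2 * (e i * f (k + d - i)) with hρ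
  have hδsum : ∀ u : ℕ → ℝ, ∑ i ∈ Finset.range (k + d + 1), δ i * u (k + d - i) = u k := by
    intro u
    rw [Finset.sum_eq_single d]
    · simp [hδ]
    · intro i _ hi
      simp [hδ, hi]
    · intro h
      simp at h
  have hgk : g k = 1 := by simp [hg, hk]
  have hbk : b k = k * ((d : ℝ) - 1 - k) := by simp [hb, hk]
  have hag : ∑ i ∈ Finset.range (k + d + 1), a i * g (k + d - i)
      = ((d : ℝ) - 1 - k) * (d + k) / 2 := sum_range_ite_Ioo k d hk
  have hmain : (signalPoly y d).coeff (k + d) - (1 - y * (((d : ℝ) - 1 - k) * (d + 3 * k) / 2))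
      = y ^ 2 * (f k + ∑ i ∈ Finset.range (k + d + 1), ρ i) := by
    have hexp : (signalPoly y d).coeff (k + d) = ∑ i ∈ Finset.range (k + d + 1),
        (δ i * g (k + d - i) - y * (δ i * b (k + d - i)) - y * (a i * g (k + d - i))
          + y ^ 2 * (δ i * f (k + d - i)) + y ^ 2 * ρ i) := by
      rw [signalPoly, coeff_mul, Finset.Nat.sum_antidiagonal_eq_sum_range_succ_mk]
      refine Finset.sum_congr rfl fun i _ => ?_
      simp only [he, hf, hρ]
      change (δ i - y * a i + y ^ 2 * e i) * (g (k + d - i) - y * b (k + d - i)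
        + y ^ 2 * f (k + d - i)) = _
      ring
    rw [hexp]
    simp only [Finset.sum_add_distrib, Finset.sum_sub_distrib, ← Finset.mul_sum]
    rw [hδsum, hδsum, hδsum, hag, hgk, hbk]
    ring
  have hbρ : ∀ i, |ρ i| ≤ 0.45 * (d : ℝ) ^ 3 := by
    intro i
    have h1 : |a i * b (k + d - i)| ≤ d * ((d : ℝ) ^ 2 / 4) := by
      rw [abs_mul]
      exact mul_le_mul (hba _) (hbb _) (abs_nonneg _) hd0
    have h2 : |e i * g (k + d - i)| ≤ (d : ℝ) ^ 3 / 10 * 1 := by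
      rw [abs_mul]
      exact mul_le_mul (hbe _) (hbg _) (abs_nonneg _) (by positivity)
    have h3 : |a i * f (k + d - i)| ≤ d * ((d : ℝ) ^ 4 / 40) := by
      rw [abs_mul]
      exact mul_le_mul (hba _) (hbf _) (abs_nonneg _) hd0
    have h4 : |e i * b (k + d - i)| ≤ (d : ℝ) ^ 3 / 10 * ((d : ℝ) ^ 2 / 4) := by
      rw [abs_mul]
      exact mul_le_mul (hbe _) (hbb _) (abs_nonneg _) (by positivity)
    have h5 : |e i * f (k + d - i)| ≤ (d : ℝ) ^ 3 / 10 * ((d : ℝ) ^ 4 / 40) := by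
      rw [abs_mul]
      exact mul_le_mul (hbe _) (hbf _) (abs_nonneg _) (by positivity)
    have h34 : |y * (a i * f (k + d - i) + e i * b (k + d - i))| ≤ (d : ℝ) ^ 3 / 20 := by
      rw [abs_mul, abs_of_nonneg hy]
      calc y * |a i * f (k + d - i) + e i * b (k + d - i)|
          ≤ y * (d * ((d : ℝ) ^ 4 / 40) + (d : ℝ) ^ 3 / 10 * ((d : ℝ) ^ 2 / 4)) := by
            gcongr
            exact (abs_add_le _ _).trans (add_le_add h3 h4)
        _ = (y * (d : ℝ) ^ 2) * ((d : ℝ) ^ 3 / 20) := by ring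
        _ ≤ 1 * ((d : ℝ) ^ 3 / 20) := by gcongr
        _ = _ := one_mul _
    have h5' : |y ^ 2 * (e i * f (k + d - i))| ≤ (d : ℝ) ^ 3 / 400 := by
      rw [abs_mul, abs_of_nonneg (sq_nonneg y)]
      calc y ^ 2 * |e i * f (k + d - i)|
          ≤ y ^ 2 * ((d : ℝ) ^ 3 / 10 * ((d : ℝ) ^ 4 / 40)) := by gcongr
        _ = (y * (d : ℝ) ^ 2) ^ 2 * ((d : ℝ) ^ 3 / 400) := by ring
        _ ≤ 1 ^ 2 * ((d : ℝ) ^ 3 / 400) := by gcongr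
        _ = _ := by ring
    have hd3 : (0 : ℝ) ≤ (d : ℝ) ^ 3 := by positivity
    have g1 := abs_le.1 h1
    have g2 := abs_le.1 h2
    have g3 := abs_le.1 h34
    have g4 := abs_le.1 h5'
    rw [abs_le]
    simp only [hρ]
    constructor <;> nlinarith
  rw [hmain, abs_mul, abs_of_nonneg (sq_nonneg y)]
  refine mul_le_mul_of_nonneg_left ?_ (sq_nonneg y)
  have hsum : |∑ i ∈ Finset.range (k + d + 1), ρ i| ≤ (2 * d) * (0.45 * (d : ℝ) ^ 3) := by
    refine (Finset.abs_sum_le_sum_abs _ _).trans ?_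
    refine (Finset.sum_le_sum fun i _ => hbρ i).trans ?_
    rw [Finset.sum_const, Finset.card_range, nsmul_eq_mul]
    gcongr
    have : k + d + 1 ≤ 2 * d := by omega
    exact_mod_cast this
  refine (abs_add_le _ _).trans ?_
  have := hbf k
  have hd4 : (0 : ℝ) ≤ (d : ℝ) ^ 4 := by positivity
  nlinarith

/-! ### The circuit in terms of the polynomials -/

/-- The point `e^{2i(ω-φ)}` of the unit circle, in which the circuit is a polynomial. -/
noncomputable def circlePoint (φ ω : ℝ) : ℂ := Complex.exp (2 * Complex.I * ((ω - φ : ℝ) : ℂ))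

theorem circlePoint_mul_conj (φ ω : ℝ) :
    circlePoint φ ω * (starRingEnd ℂ) (circlePoint φ ω) = 1 := by
  rw [circlePoint, ← Complex.exp_conj, ← Complex.exp_add]
  simp [map_ofNat]

theorem circuit_row_zero (n : ℕ) (θ φ χ ω : ℝ) (hc : Real.cos θ ≠ 0) :
    circuit n θ φ χ ω 0 0 = (Real.cos θ : ℂ) ^ n
      * Complex.exp (-(Complex.I * ((ω - φ : ℝ) : ℂ))) ^ n
      * aeval (circlePoint φ ω) (rowPoly (Real.tan θ ^ 2) n).1 ∧
    circuit n θ φ χ ω 0 1 = (Real.cos θ : ℂ) ^ n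
      * Complex.exp (-(Complex.I * ((ω - φ : ℝ) : ℂ))) ^ n
      * (-Complex.I * Real.tan θ * Complex.exp (Complex.I * ((φ + χ : ℝ) : ℂ)) * circlePoint φ ω
        * aeval (circlePoint φ ω) (rowPoly (Real.tan θ ^ 2) n).2) := by
  induction n with
  | zero => simp [circuit, rowPoly]
  | succ n ih =>
    obtain ⟨ih0, ih1⟩ := ih
    have hs : (Real.sin θ : ℂ) = Real.tan θ * Real.cos θ := by
      exact_mod_cast (Real.tan_mul_cos hc).symm
    set E := Complex.exp (-(Complex.I * ((ω - φ : ℝ) : ℂ))) with hE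
    set z := circlePoint φ ω with hz
    set W := Complex.exp (Complex.I * ((φ + χ : ℝ) : ℂ)) with hW
    have e00 : (zRotation ω * fsimGate θ φ χ) 0 0 = E * z * Real.cos θ := by
      simp only [zRotation, fsimGate, Matrix.mul_apply, Fin.sum_univ_two, hE, hz, circlePoint]
      simp [← mul_assoc, ← Complex.exp_add]
      left
      ring_nf
    have e11 : (zRotation ω * fsimGate θ φ χ) 1 1 = E * Real.cos θ := by
      simp only [zRotation, fsimGate, Matrix.mul_apply, Fin.sum_univ_two, hE]
      simp [← mul_assoc, ← Complex.exp_add]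
      left
      ring_nf
    have e01 : (zRotation ω * fsimGate θ φ χ) 0 1
        = E * z * (-Complex.I * W * (Real.tan θ * Real.cos θ)) := by
      have h : E * z * W = Complex.exp (Complex.I * ω) * Complex.exp (Complex.I * χ) := by
        simp only [hE, hz, hW, circlePoint, ← Complex.exp_add]
        congr 1
        push_cast
        ring
      rw [← hs]
      simp only [zRotation, fsimGate, Matrix.mul_apply, Fin.sum_univ_two]
      simp
      linear_combination (-Complex.I * Complex.sin θ) * h
    have e10 : W * (zRotation ω * fsimGate θ φ χ) 1 0
        = E * (-Complex.I * (Real.tan θ * Real.cos θ)) := by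
      have h : E = W * Complex.exp (-(Complex.I * ω)) * Complex.exp (-(Complex.I * χ)) := by
        simp only [hE, hW, ← Complex.exp_add]
        congr 1
        push_cast
        ring
      rw [← hs]
      simp only [zRotation, fsimGate, Matrix.mul_apply, Fin.sum_univ_two]
      simp
      linear_combination (-Complex.I * Complex.sin θ) * h
    have step : ∀ j, circuit (n + 1) θ φ χ ω 0 j
        = circuit n θ φ χ ω 0 0 * (zRotation ω * fsimGate θ φ χ) 0 j
          + circuit n θ φ χ ω 0 1 * (zRotation ω * fsimGate θ φ χ) 1 j := by
      intro j
      rw [circuit, pow_succ, Matrix.mul_apply, Fin.sum_univ_two]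
      rfl
    constructor
    · rw [step, ih0, ih1, e00]
      simp only [rowPoly, map_mul, map_sub, aeval_X, aeval_C, Complex.coe_algebraMap,
        Complex.ofReal_pow]
      linear_combination ((Real.cos θ : ℂ) ^ n * E ^ n * (-Complex.I * Real.tan θ * z
        * aeval z (rowPoly (Real.tan θ ^ 2) n).2)) * e10
        + (Real.cos θ : ℂ) ^ (n + 1) * E ^ (n + 1) * (Real.tan θ : ℂ) ^ 2 * z
        * aeval z (rowPoly (Real.tan θ ^ 2) n).2 * Complex.I_sq
    · rw [step, ih0, ih1, e01, e11]
      simp only [rowPoly, map_add]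
      ring

/-- The reconstructed function is the product of the first entry of the first row of the circuit and
the conjugate of the second. -/
theorem reconstructed_eq_mul_conj (d : ℕ) (θ φ χ ω : ℝ)
    (hnorm : ‖circuit d θ φ χ ω 0 0‖ ^ 2 + ‖circuit d θ φ χ ω 0 1‖ ^ 2 = 1) :
    reconstructed d θ φ χ ω
      = circuit d θ φ χ ω 0 0 * (starRingEnd ℂ) (circuit d θ φ χ ω 0 1) := by
  have h2 : (Real.sqrt 2) ^ 2 = 2 := Real.sq_sqrt (by norm_num)
  have hinv : (Real.sqrt 2)⁻¹ * (Real.sqrt 2)⁻¹ = 1 / 2 := by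
    rw [← mul_inv, ← sq, h2]
    norm_num
  simp only [← Complex.normSq_eq_norm_sq, Complex.normSq_apply] at hnorm
  have hX : prob .X d θ φ χ ω = 1 / 2 + (circuit d θ φ χ ω 0 0
      * (starRingEnd ℂ) (circuit d θ φ χ ω 0 1)).re := by
    simp only [prob, bellState, Matrix.mulVec, dotProduct, Fin.sum_univ_two,
      ← Complex.normSq_eq_norm_sq, Complex.normSq_apply]
    simp [← Complex.ofReal_inv]
    generalize (circuit d θ φ χ ω 0 0).re = a at *
    generalize (circuit d θ φ χ ω 0 0).im = b at *
    generalize (circuit d θ φ χ ω 0 1).re = a' at *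
    generalize (circuit d θ φ χ ω 0 1).im = b' at *
    linear_combination ((a + a') ^ 2 + (b + b') ^ 2) * hinv + hnorm / 2
  have hY : prob .Y d θ φ χ ω = 1 / 2 + (circuit d θ φ χ ω 0 0
      * (starRingEnd ℂ) (circuit d θ φ χ ω 0 1)).im := by
    simp only [prob, bellState, Matrix.mulVec, dotProduct, Fin.sum_univ_two,
      ← Complex.normSq_eq_norm_sq, Complex.normSq_apply]
    simp [div_eq_mul_inv, ← Complex.ofReal_inv]
    generalize (circuit d θ φ χ ω 0 0).re = a at *
    generalize (circuit d θ φ χ ω 0 0).im = b at *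
    generalize (circuit d θ φ χ ω 0 1).re = a' at *
    generalize (circuit d θ φ χ ω 0 1).im = b' at *
    linear_combination ((a - b') ^ 2 + (b + a') ^ 2) * hinv + hnorm / 2
  apply Complex.ext
  · simp [reconstructed, hX]
  · simp [reconstructed, hY]

theorem circuit_mem_unitary (d : ℕ) (θ φ χ ω : ℝ) :
    circuit d θ φ χ ω ∈ Matrix.unitaryGroup (Fin 2) ℂ := by
  refine pow_mem (mul_mem ?_ ?_) d
  · rw [Matrix.mem_unitaryGroup_iff]
    ext i j
    fin_cases i <;> fin_cases j <;>
      simp [zRotation, Matrix.mul_apply, Fin.sum_univ_two, Matrix.star_apply, ← Complex.exp_conj,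
        ← Complex.exp_add]
  · have hcs : (Complex.cos θ) ^ 2 + (Complex.sin θ) ^ 2 = 1 := Complex.cos_sq_add_sin_sq θ
    have h1 : ∀ x : ℝ, Complex.exp (Complex.I * x) * Complex.exp (-(Complex.I * x)) = 1 := by
      intro x
      rw [← Complex.exp_add]
      simp
    rw [Matrix.mem_unitaryGroup_iff]
    ext i j
    fin_cases i <;> fin_cases j <;>
      simp [fsimGate, Matrix.mul_apply, Fin.sum_univ_two, Matrix.star_apply, ← Complex.exp_conj,
        ← Complex.cos_conj, ← Complex.sin_conj]
    · linear_combination hcs + Complex.cos θ ^ 2 * h1 φ + Complex.sin θ ^ 2 * h1 χ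
        - Complex.exp (Complex.I * χ) * Complex.exp (-(Complex.I * χ)) * Complex.sin θ ^ 2
        * Complex.I_sq
    · ring
    · ring
    · linear_combination hcs + Complex.cos θ ^ 2 * h1 φ + Complex.sin θ ^ 2 * h1 χ
        - Complex.exp (Complex.I * χ) * Complex.exp (-(Complex.I * χ)) * Complex.sin θ ^ 2
        * Complex.I_sq

theorem norm_sq_circuit_row (d : ℕ) (θ φ χ ω : ℝ) :
    ‖circuit d θ φ χ ω 0 0‖ ^ 2 + ‖circuit d θ φ χ ω 0 1‖ ^ 2 = 1 := by
  have h := (Matrix.mem_unitaryGroup_iff.1 (circuit_mem_unitary d θ φ χ ω))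
  have h00 := congrFun (congrFun h 0) 0
  simp only [Matrix.mul_apply, Fin.sum_univ_two, Matrix.star_apply, Matrix.one_apply_eq,
    RCLike.star_def, Complex.mul_conj, Complex.normSq_eq_norm_sq] at h00
  exact_mod_cast h00

theorem norm_sq_reconstructed_le (d : ℕ) (θ φ χ ω : ℝ) :
    ‖reconstructed d θ φ χ ω‖ ^ 2 ≤ 1 / 4 := by
  have h := norm_sq_circuit_row d θ φ χ ω
  rw [reconstructed_eq_mul_conj d θ φ χ ω h, norm_mul, RCLike.norm_conj, mul_pow]
  nlinarith [sq_nonneg (‖circuit d θ φ χ ω 0 0‖ ^ 2 - ‖circuit d θ φ χ ω 0 1‖ ^ 2)]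

/-- The common factor `i sin θ cos^(2d-1) θ e^{-i(φ+χ)}` of all the Fourier coefficients. -/
noncomputable def signalPrefactor (d : ℕ) (θ φ χ : ℝ) : ℂ :=
  Complex.I * Real.sin θ * (Real.cos θ : ℂ) ^ (2 * d - 1)
    * Complex.exp (-(Complex.I * ((φ + χ : ℝ) : ℂ)))

/-- The finite Fourier expansion of the reconstructed function. -/
theorem reconstructed_eq_sum {d : ℕ} (hd : 1 ≤ d) (θ φ χ ω : ℝ) (hc : Real.cos θ ≠ 0) :
    reconstructed d θ φ χ ω = signalPrefactor d θ φ χ * ∑ m ∈ Finset.range (2 * d),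
      ((signalPoly (Real.tan θ ^ 2) d).coeff m : ℂ)
        * Complex.exp (2 * Complex.I * ((m : ℂ) - d) * ((ω - φ : ℝ) : ℂ)) := by
  obtain ⟨h0, h1⟩ := circuit_row_zero d θ φ χ ω hc
  rw [reconstructed_eq_mul_conj d θ φ χ ω (norm_sq_circuit_row d θ φ χ ω), h0, h1]
  have hz := circlePoint_mul_conj φ ω
  have hrev := pow_mul_conj_aeval_rowPoly (Real.tan θ ^ 2) hz d
  have hs : (Real.sin θ : ℂ) = Real.tan θ * Real.cos θ := by
    exact_mod_cast (Real.tan_mul_cos hc).symm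
  have hsum : ∑ m ∈ Finset.range (2 * d), ((signalPoly (Real.tan θ ^ 2) d).coeff m : ℂ)
      * Complex.exp (2 * Complex.I * ((m : ℂ) - d) * ((ω - φ : ℝ) : ℂ))
      = (starRingEnd ℂ) (circlePoint φ ω) ^ d
        * (aeval (circlePoint φ ω) (rowPoly (Real.tan θ ^ 2) d).1
        * aeval (circlePoint φ ω) (rowPoly (Real.tan θ ^ 2) d).2) := by
    rw [← map_mul, ← signalPoly, aeval_eq_sum_range' (natDegree_signalPoly_lt _ hd), Finset.mul_sum]
    refine Finset.sum_congr rfl fun m _ => ?_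
    rw [Complex.real_smul]
    have : Complex.exp (2 * Complex.I * ((m : ℂ) - d) * ((ω - φ : ℝ) : ℂ))
        = (starRingEnd ℂ) (circlePoint φ ω) ^ d * circlePoint φ ω ^ m := by
      rw [circlePoint, ← Complex.exp_conj, ← Complex.exp_nat_mul, ← Complex.exp_nat_mul,
        ← Complex.exp_add]
      congr 1
      simp [map_ofNat]
      ring
    rw [this]
    ring
  rw [hsum, signalPrefactor, hs]
  have hE : Complex.exp (-(Complex.I * ((ω - φ : ℝ) : ℂ)))
      * (starRingEnd ℂ) (Complex.exp (-(Complex.I * ((ω - φ : ℝ) : ℂ)))) = 1 := by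
    rw [← Complex.exp_conj, ← Complex.exp_add]
    simp
  have hW : (starRingEnd ℂ) (Complex.exp (Complex.I * ((φ + χ : ℝ) : ℂ)))
      = Complex.exp (-(Complex.I * ((φ + χ : ℝ) : ℂ))) := by
    rw [← Complex.exp_conj]
    simp
  simp only [map_mul, map_pow, map_neg, Complex.conj_ofReal, Complex.conj_I, hW]
  set E := Complex.exp (-(Complex.I * ((ω - φ : ℝ) : ℂ)))
  set z := circlePoint φ ω
  set p := aeval z (rowPoly (Real.tan θ ^ 2) d).1
  set r := aeval z (rowPoly (Real.tan θ ^ 2) d).2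
  have hEd : E ^ d * (starRingEnd ℂ) E ^ d = 1 := by rw [← mul_pow, hE, one_pow]
  have hzd : z ^ d * (starRingEnd ℂ) z ^ d = 1 := by rw [← mul_pow, hz, one_pow]
  have hzr : (starRingEnd ℂ) z * (starRingEnd ℂ) r = (starRingEnd ℂ) z ^ d * r := by
    calc (starRingEnd ℂ) z * (starRingEnd ℂ) r
        = (starRingEnd ℂ) z * (starRingEnd ℂ) r * (z ^ d * (starRingEnd ℂ) z ^ d) := by
          rw [hzd, mul_one]
      _ = (starRingEnd ℂ) z ^ d * (starRingEnd ℂ) z * (z ^ d * (starRingEnd ℂ) r) := by ring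
      _ = (starRingEnd ℂ) z ^ d * r * (z * (starRingEnd ℂ) z) := by rw [hrev]; ring
      _ = _ := by rw [hz, mul_one]
  obtain ⟨m, rfl⟩ := Nat.exists_eq_add_of_le' hd
  have hm : 2 * (m + 1) - 1 = 2 * m + 1 := by omega
  rw [hm]
  set V := Complex.exp (-(Complex.I * ((φ + χ : ℝ) : ℂ)))
  set c : ℂ := (Real.cos θ : ℂ)
  set t : ℂ := (Real.tan θ : ℂ)
  calc _ = (E ^ (m + 1) * (starRingEnd ℂ) E ^ (m + 1)) * c ^ (2 * m + 2) * p * Complex.I * t * V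
        * ((starRingEnd ℂ) z * (starRingEnd ℂ) r) := by ring
    _ = _ := by rw [hEd, hzr]; ring

/-! ### Fourier coefficients -/

theorem integral_exp_two_mul_int (n : ℤ) :
    ∫ ω in (0 : ℝ)..Real.pi, Complex.exp (2 * Complex.I * n * ω)
      = if n = 0 then (Real.pi : ℂ) else 0 := by
  split_ifs with h
  · simp [h]
  · have hn : (2 * Complex.I * n : ℂ) ≠ 0 := by
      simp [h]
    rw [integral_exp_mul_complex hn]
    have : Complex.exp (2 * Complex.I * n * Real.pi) = 1 := by
      rw [Complex.exp_eq_one_iff]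
      exact ⟨n, by ring⟩
    simp [this]

theorem sum_exp_two_pi_mul_div (N : ℕ) (hN : 0 < N) (n : ℤ) (hn : |n| < N) :
    ∑ j : Fin N, Complex.exp (2 * Real.pi * Complex.I * (j : ℕ) * n / N)
      = if n = 0 then (N : ℂ) else 0 := by
  have hN' : (N : ℂ) ≠ 0 := by exact_mod_cast hN.ne'
  split_ifs with h
  · simp [h]
  · set ζ := Complex.exp (2 * Real.pi * Complex.I * n / N) with hζ
    have h1 : ∀ j : ℕ, Complex.exp (2 * Real.pi * Complex.I * j * n / N) = ζ ^ j := by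
      intro j
      rw [hζ, ← Complex.exp_nat_mul]
      congr 1
      ring
    simp only [h1]
    rw [Fin.sum_univ_eq_sum_range (fun j => ζ ^ j) N]
    have hne : ζ ≠ 1 := by
      intro h2
      obtain ⟨m, hm⟩ := Complex.exp_eq_one_iff.1 h2
      have h3 : (n : ℂ) = m * N := by
        have h4 : (2 * Real.pi * Complex.I : ℂ) ≠ 0 := by simp [Real.pi_ne_zero]
        field_simp at hm
        linear_combination hm
      have h5 : n = m * N := by exact_mod_cast h3
      exact h (Int.eq_zero_of_abs_lt_dvd ⟨m, by rw [h5]; ring⟩ hn)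
    have hpow : ζ ^ N = 1 := by
      rw [← h1, Complex.exp_eq_one_iff]
      exact ⟨n, by field_simp⟩
    rw [geom_sum_eq hne, hpow]
    simp

theorem fourierCoefficient_eq {d : ℕ} (hd : 1 ≤ d) (θ φ χ : ℝ) (hc : Real.cos θ ≠ 0) {k : ℕ}
    (hk : k < d) :
    fourierCoefficient d θ φ χ k = signalPrefactor d θ φ χ
      * ((signalPoly (Real.tan θ ^ 2) d).coeff (k + d) : ℂ)
      * Complex.exp (-(2 * Complex.I * k * φ)) := by
  have hint : ∀ ω : ℝ, reconstructed d θ φ χ ω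
      * Complex.exp (-(2 * Complex.I * ((k : ℤ) : ℂ) * (ω : ℂ)))
      = ∑ m ∈ Finset.range (2 * d), signalPrefactor d θ φ χ
        * ((signalPoly (Real.tan θ ^ 2) d).coeff m : ℂ)
        * Complex.exp (-(2 * Complex.I * ((m : ℂ) - d) * φ))
        * Complex.exp (2 * Complex.I * ((m - d - k : ℤ) : ℂ) * ω) := by
    intro ω
    rw [reconstructed_eq_sum hd θ φ χ ω hc, Finset.mul_sum, Finset.sum_mul]
    refine Finset.sum_congr rfl fun m _ => ?_
    have hexp : Complex.exp (2 * Complex.I * ((m : ℂ) - d) * ((ω - φ : ℝ) : ℂ))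
        * Complex.exp (-(2 * Complex.I * ((k : ℤ) : ℂ) * (ω : ℂ)))
        = Complex.exp (-(2 * Complex.I * ((m : ℂ) - d) * φ))
          * Complex.exp (2 * Complex.I * ((m - d - k : ℤ) : ℂ) * ω) := by
      rw [← Complex.exp_add, ← Complex.exp_add]
      congr 1
      push_cast
      ring
    linear_combination (signalPrefactor d θ φ χ
      * ((signalPoly (Real.tan θ ^ 2) d).coeff m : ℂ)) * hexp
  rw [fourierCoefficient]
  simp only [hint]
  rw [intervalIntegral.integral_finsetSum]
  · simp only [intervalIntegral.integral_const_mul, integral_exp_two_mul_int]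
    rw [Finset.sum_eq_single (k + d)]
    · have : ((k + d : ℕ) - d - k : ℤ) = 0 := by push_cast; ring
      rw [if_pos this]
      push_cast
      have hpi : (Real.pi : ℂ) ≠ 0 := by exact_mod_cast Real.pi_ne_zero
      field_simp
      congr 2
      ring
    · intro m _ hm
      rw [if_neg (by omega), mul_zero]
    · intro h
      simp at h
      omega
  · intro m _
    apply Continuous.intervalIntegrable
    fun_prop

/-- There is no aliasing: the discrete Fourier transform of the exact values at the `2d-1` sampling
angles returns the Fourier coefficient. -/
theorem sum_exp_mul_reconstructed {d : ℕ} (hd : 1 ≤ d) (θ φ χ : ℝ) (hc : Real.cos θ ≠ 0) {k : ℕ}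
    (hk : k < d) :
    (1 / (2 * (d : ℂ) - 1)) * ∑ j : Fin (2 * d - 1),
      Complex.exp (-(2 * Real.pi * Complex.I * ((j : ℕ) : ℂ) * ((k : ℤ) : ℂ) / (2 * (d : ℂ) - 1)))
        * reconstructed d θ φ χ (samplingAngle d j) = fourierCoefficient d θ φ χ k := by
  rw [fourierCoefficient_eq hd θ φ χ hc hk]
  have hN : (2 * (d : ℂ) - 1) = ((2 * d - 1 : ℕ) : ℂ) := by
    rw [Nat.cast_sub (by omega)]
    push_cast
    ring
  have hN0 : ((2 * d - 1 : ℕ) : ℂ) ≠ 0 := by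
    have : 2 * d - 1 ≠ 0 := by omega
    exact_mod_cast this
  have hterm : ∀ j : Fin (2 * d - 1),
      Complex.exp (-(2 * Real.pi * Complex.I * ((j : ℕ) : ℂ) * ((k : ℤ) : ℂ) / (2 * (d : ℂ) - 1)))
        * reconstructed d θ φ χ (samplingAngle d j)
      = ∑ m ∈ Finset.range (2 * d), signalPrefactor d θ φ χ
        * ((signalPoly (Real.tan θ ^ 2) d).coeff m : ℂ)
        * Complex.exp (-(2 * Complex.I * ((m : ℂ) - d) * φ))
        * Complex.exp (2 * Real.pi * Complex.I * ((j : ℕ) : ℂ) * ((m - d - k : ℤ) : ℂ)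
          / ((2 * d - 1 : ℕ) : ℂ)) := by
    intro j
    rw [reconstructed_eq_sum hd θ φ χ _ hc, Finset.mul_sum, Finset.mul_sum]
    refine Finset.sum_congr rfl fun m _ => ?_
    have hexp : Complex.exp (-(2 * Real.pi * Complex.I * ((j : ℕ) : ℂ) * ((k : ℤ) : ℂ)
        / (2 * (d : ℂ) - 1)))
        * Complex.exp (2 * Complex.I * ((m : ℂ) - d) * ((samplingAngle d j - φ : ℝ) : ℂ))
        = Complex.exp (-(2 * Complex.I * ((m : ℂ) - d) * φ))
          * Complex.exp (2 * Real.pi * Complex.I * ((j : ℕ) : ℂ) * ((m - d - k : ℤ) : ℂ)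
          / ((2 * d - 1 : ℕ) : ℂ)) := by
      rw [← Complex.exp_add, ← Complex.exp_add]
      congr 1
      rw [← hN] at hN0 ⊢
      simp only [samplingAngle]
      push_cast
      field_simp
      ring
    linear_combination (signalPrefactor d θ φ χ
      * ((signalPoly (Real.tan θ ^ 2) d).coeff m : ℂ)) * hexp
  simp only [hterm]
  rw [Finset.sum_comm, Finset.sum_eq_single (k + d)]
  · rw [← Finset.mul_sum, sum_exp_two_pi_mul_div _ (by omega)]
    · have : ((k + d : ℕ) - d - k : ℤ) = 0 := by push_cast; ring
      rw [if_pos this, hN]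
      push_cast [-Nat.cast_sub]
      field_simp
      congr 3
      ring
    · have : ((k + d : ℕ) - d - k : ℤ) = 0 := by push_cast; ring
      rw [this, abs_zero]
      exact_mod_cast (by omega : 0 < 2 * d - 1)
  · intro m hm hmk
    rcases Nat.eq_zero_or_pos m with rfl | hm0
    · simp [signalPoly_coeff_zero _ hd]
    · rw [Finset.mem_range] at hm
      rw [← Finset.mul_sum, sum_exp_two_pi_mul_div _ (by omega), if_neg (by omega), mul_zero]
      rw [abs_lt]
      omega
  · intro h
    simp at h
    omega

/-! ### Lower bound for the signal -/

theorem cos_pos_of_abs_lt_one {θ : ℝ} (hθ : |θ| < 1) : 0 < Real.cos θ := by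
  have := abs_lt.1 hθ
  exact Real.cos_pos_of_mem_Ioo ⟨by linarith [Real.pi_gt_three], by linarith [Real.pi_gt_three]⟩

theorem tan_sq_bounds {d : ℕ} (hd : 2 ≤ d) {θ : ℝ} (hc : 0 < Real.cos θ)
    (hθ : (d : ℝ) ^ 5 * θ ^ 4 < 1) :
    Real.tan θ ^ 2 * (d : ℝ) ^ 2 ≤ 1 ∧
      (Real.tan θ ^ 2) ^ 2 * (d : ℝ) ^ 4 ≤ 2 * (d : ℝ) ^ 5 * θ ^ 4 := by
  have hd2 : (2 : ℝ) ≤ d := by exact_mod_cast hd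
  have hs : Real.sin θ ^ 2 ≤ θ ^ 2 := sq_le_sq.2 Real.abs_sin_le_abs
  have hcs := Real.sin_sq_add_cos_sq θ
  have hd2θ : (d : ℝ) ^ 2 * θ ^ 2 ≤ 0.71 := by
    have h1 : ((d : ℝ) ^ 2 * θ ^ 2) ^ 2 ≤ 1 / 2 := by
      have h2 : 0 ≤ (d : ℝ) ^ 4 * θ ^ 4 := by positivity
      nlinarith
    nlinarith
  have hθ2 : θ ^ 2 ≤ 0.1775 := by
    have : 2 ^ 2 * θ ^ 2 ≤ (d : ℝ) ^ 2 * θ ^ 2 := by gcongr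
    linarith
  have hc2 : 0.8225 ≤ Real.cos θ ^ 2 := by linarith
  have hyc : Real.tan θ ^ 2 * Real.cos θ ^ 2 = Real.sin θ ^ 2 := by
    rw [← mul_pow, Real.tan_mul_cos hc.ne']
  have hy0 : 0 ≤ Real.tan θ ^ 2 := sq_nonneg _
  generalize Real.tan θ ^ 2 = y at *
  have hyθ : 0.8225 * y ≤ θ ^ 2 := by
    have := mul_le_mul_of_nonneg_left hc2 hy0
    linarith
  constructor
  · have : 0.8225 * y * (d : ℝ) ^ 2 ≤ θ ^ 2 * (d : ℝ) ^ 2 := by gcongr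
    linarith
  · have h3 : y ^ 2 ≤ 2 * θ ^ 4 := by
      have := mul_self_le_mul_self (by positivity) hyθ
      nlinarith
    calc y ^ 2 * (d : ℝ) ^ 4 ≤ 2 * θ ^ 4 * (d : ℝ) ^ 4 := by gcongr
      _ = 2 * (d : ℝ) ^ 4 * θ ^ 4 := by ring
      _ ≤ 2 * (d : ℝ) ^ 5 * θ ^ 4 := by gcongr <;> linarith

/-- The loss in the modulus of the `k`-th Fourier coefficient relative to `cos^(2d-1) θ`: the term
of first order in `θ²` is exact, the others are covered by `2 d⁵ θ⁴`. -/
theorem cos_pow_mul_one_sub_signalPoly_coeff_le {d : ℕ} (hd : 1 ≤ d) {θ : ℝ}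
    (hc : 0 < Real.cos θ) (hθ : (d : ℝ) ^ 5 * θ ^ 4 < 1) {k : ℕ} (hk : k < d) :
    Real.cos θ ^ (2 * d - 1) * (1 - (signalPoly (Real.tan θ ^ 2) d).coeff (k + d))
      ≤ ((d : ℝ) - 1 - k) * (d + 3 * k) / 2 * θ ^ 2 + 2 * (d : ℝ) ^ 5 * θ ^ 4 := by
  have hk1 : (k : ℝ) + 1 ≤ d := by exact_mod_cast hk
  have hk0 : (0 : ℝ) ≤ (d : ℝ) - 1 - k := by linarith
  have hN₁ : 0 ≤ ((d : ℝ) - 1 - k) * (d + 3 * k) / 2 := by positivity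
  rcases hd.eq_or_lt with rfl | hd2
  -- For `d = 1` there is no loss; the bounds on `tan θ` below need `2 ≤ d`.
  · obtain rfl : k = 0 := by omega
    have hq1 : (signalPoly (Real.tan θ ^ 2) 1).coeff (0 + 1) = 1 := by
      simp [signalPoly, rowPoly]
    rw [hq1, sub_self, mul_zero]
    positivity
  · obtain ⟨hyd, hy2⟩ := tan_sq_bounds hd2 hc hθ
    have h := (abs_le.1 (abs_signalPoly_coeff_sub_le (sq_nonneg (Real.tan θ)) hk hyd)).1
    have hXy : Real.cos θ ^ (2 * d - 1) * Real.tan θ ^ 2 ≤ θ ^ 2 := by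
      calc Real.cos θ ^ (2 * d - 1) * Real.tan θ ^ 2 ≤ Real.cos θ ^ 2 * Real.tan θ ^ 2 := by
            refine mul_le_mul_of_nonneg_right ?_ (sq_nonneg _)
            exact pow_le_pow_of_le_one hc.le (Real.cos_le_one θ) (by omega)
        _ = Real.sin θ ^ 2 := by rw [← mul_pow, mul_comm, Real.tan_mul_cos hc.ne']
        _ ≤ θ ^ 2 := sq_le_sq.2 Real.abs_sin_le_abs
    have hX0 : 0 ≤ Real.cos θ ^ (2 * d - 1) := by positivity
    have hX1 : Real.cos θ ^ (2 * d - 1) ≤ 1 := pow_le_one₀ hc.le (Real.cos_le_one θ)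
    generalize (signalPoly (Real.tan θ ^ 2) d).coeff (k + d) = q at *
    generalize Real.cos θ ^ (2 * d - 1) = X at *
    generalize ((d : ℝ) - 1 - k) * (d + 3 * k) / 2 = N₁ at *
    generalize Real.tan θ ^ 2 = y at *
    calc X * (1 - q) ≤ X * (y * N₁ + y ^ 2 * (d : ℝ) ^ 4) := by
          refine mul_le_mul_of_nonneg_left ?_ hX0
          linarith
      _ = (X * y) * N₁ + X * (y ^ 2 * (d : ℝ) ^ 4) := by ring
      _ ≤ θ ^ 2 * N₁ + 1 * (2 * (d : ℝ) ^ 5 * θ ^ 4) := by gcongr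
      _ = _ := by ring

theorem one_sub_le_cos_pow_sq {d : ℕ} (hd : 1 ≤ d) (θ : ℝ) :
    1 - (2 * d - 1) * θ ^ 2 ≤ (Real.cos θ ^ (2 * d - 1)) ^ 2 := by
  have hd1 : (1 : ℝ) ≤ d := by exact_mod_cast hd
  have hs : Real.sin θ ^ 2 ≤ θ ^ 2 := sq_le_sq.2 Real.abs_sin_le_abs
  have h := one_add_mul_le_pow (a := -Real.sin θ ^ 2)
    (by nlinarith [Real.sin_sq_le_one θ]) (2 * d - 1)
  rw [Nat.cast_sub (by omega)] at h
  push_cast at h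
  have h2 : (Real.cos θ ^ (2 * d - 1)) ^ 2 = (1 + -Real.sin θ ^ 2) ^ (2 * d - 1) := by
    rw [← pow_mul, mul_comm, pow_mul, Real.cos_sq']
    ring
  have h3 := mul_le_mul_of_nonneg_left hs (by linarith : (0 : ℝ) ≤ 2 * d - 1)
  rw [h2]
  linarith

theorem norm_sq_fourierCoefficient {d : ℕ} (hd : 1 ≤ d) {θ : ℝ} (φ χ : ℝ) (hc : Real.cos θ ≠ 0)
    {k : ℕ} (hk : k < d) :
    ‖fourierCoefficient d θ φ χ k‖ ^ 2 = Real.sin θ ^ 2 * (Real.cos θ ^ (2 * d - 1)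
      * (signalPoly (Real.tan θ ^ 2) d).coeff (k + d)) ^ 2 := by
  have h1 : ‖Complex.exp (-(2 * Complex.I * k * φ))‖ = 1 := by
    have : -(2 * Complex.I * k * φ) = ((-(2 * k * φ) : ℝ) : ℂ) * Complex.I := by
      push_cast
      ring
    rw [this, Complex.norm_exp_ofReal_mul_I]
  have h2 : ‖Complex.exp (-(Complex.I * ((φ + χ : ℝ) : ℂ)))‖ = 1 := by
    have : -(Complex.I * ((φ + χ : ℝ) : ℂ)) = ((-(φ + χ) : ℝ) : ℂ) * Complex.I := by
      push_cast
      ring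
    rw [this, Complex.norm_exp_ofReal_mul_I]
  rw [fourierCoefficient_eq hd θ φ χ hc hk, signalPrefactor]
  simp only [norm_mul, norm_pow, h1, h2, Complex.norm_I, Complex.norm_real, Real.norm_eq_abs]
  rw [one_mul, mul_one, mul_one, ← abs_pow, ← abs_mul, ← abs_mul, sq_abs]
  ring

/-- The signal `|c_k|²` is at least `sin² θ` up to a relative loss with leading term `4/3 (d θ)²`. -/
theorem norm_sq_fourierCoefficient_ge {d : ℕ} (hd : 1 ≤ d) {θ : ℝ} (φ χ : ℝ)
    (hc : 0 < Real.cos θ) (hθ : (d : ℝ) ^ 5 * θ ^ 4 < 1) {k : ℕ} (hk : k < d) :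
    Real.sin θ ^ 2 * (1 - 4 / 3 * ((d : ℝ) * θ) ^ 2 * (1 + 3 * (d : ℝ) ^ 3 * θ ^ 2))
      ≤ ‖fourierCoefficient d θ φ χ k‖ ^ 2 := by
  rw [norm_sq_fourierCoefficient hd φ χ hc.ne' hk]
  refine mul_le_mul_of_nonneg_left ?_ (sq_nonneg _)
  have hZ := cos_pow_mul_one_sub_signalPoly_coeff_le hd hc hθ hk
  have hXsq := one_sub_le_cos_pow_sq hd θ
  have hX0 : 0 ≤ Real.cos θ ^ (2 * d - 1) := by positivity
  have hX1 : Real.cos θ ^ (2 * d - 1) ≤ 1 := pow_le_one₀ hc.le (Real.cos_le_one θ)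
  generalize (signalPoly (Real.tan θ ^ 2) d).coeff (k + d) = q at *
  generalize Real.cos θ ^ (2 * d - 1) = X at *
  have hk1 : (k : ℝ) + 1 ≤ d := by exact_mod_cast hk
  have hk0 : (0 : ℝ) ≤ (d : ℝ) - 1 - k := by linarith
  have hN₁ : 0 ≤ ((d : ℝ) - 1 - k) * (d + 3 * k) / 2 := by positivity
  -- As a function of real `k` the left-hand side is largest at `k = d/3 - 1/2`, where it equals
  -- `4/3 d² - 1/4`.
  have hfirst : (2 * d - 1) + 2 * (((d : ℝ) - 1 - k) * (d + 3 * k) / 2) ≤ 4 / 3 * (d : ℝ) ^ 2 := by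
    nlinarith [sq_nonneg ((k : ℝ) - (d / 3 - 1 / 2))]
  generalize ((d : ℝ) - 1 - k) * (d + 3 * k) / 2 = N₁ at *
  have hB0 : 0 ≤ N₁ * θ ^ 2 + 2 * (d : ℝ) ^ 5 * θ ^ 4 := by positivity
  have hXZ : X * (X * (1 - q)) ≤ N₁ * θ ^ 2 + 2 * (d : ℝ) ^ 5 * θ ^ 4 :=
    (mul_le_mul_of_nonneg_left hZ hX0).trans (mul_le_of_le_one_left hB0 hX1)
  have hfirst' := mul_le_mul_of_nonneg_right hfirst (sq_nonneg θ)
  -- `(X q)² ≥ X² - 2 X (X - X q)`, whatever the sign of `q`.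
  have hsq : X ^ 2 - 2 * (X * (X * (1 - q))) ≤ (X * q) ^ 2 := by
    linarith [sq_nonneg (X * (1 - q))]
  linarith

/-! ### Variance of the sampling error -/

section Noise

theorem one_sub_bit_eq_indicator {Ω : Type*} (b : Ω → Fin 2) :
    (fun w => 1 - ((b w : ℕ) : ℝ)) = {w | b w = 0}.indicator 1 := by
  funext w
  by_cases h : b w = 0
  · simp [h]
  · have h1 : b w = 1 := by omega
    simp [h1]

variable {Ω : Type*} [MeasurableSpace Ω] {P : Measure Ω}

theorem variance_one_sub_bit [IsProbabilityMeasure P] {b : Ω → Fin 2} (hb : Measurable b) :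
    Var[fun w => 1 - ((b w : ℕ) : ℝ); P]
      = P.real {w | b w = 0} * (1 - P.real {w | b w = 0}) := by
  have hm : MeasurableSet {w | b w = 0} := hb (measurableSet_singleton 0)
  have hL : MemLp ({w | b w = 0}.indicator (1 : Ω → ℝ)) 2 P :=
    memLp_indicator_const 2 hm 1 (Or.inr (measure_ne_top P _))
  rw [one_sub_bit_eq_indicator, variance_eq_sub hL]
  have hsq : ({w | b w = 0}.indicator (1 : Ω → ℝ)) ^ 2 = {w | b w = 0}.indicator 1 := by
    funext w
    by_cases h : b w = 0 <;> simp [h]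
  rw [hsq, integral_indicator_one hm]
  ring

theorem integrable_and_integral_sq_sum_bits [IsProbabilityMeasure P] {ι : Type*} [Fintype ι]
    {b : ι → Ω → Fin 2} (hb : ∀ s, Measurable (b s)) (hi : iIndepFun b P) (u : ι → ℝ) :
    Integrable (fun w => (∑ s, u s * (1 - ((b s w : ℕ) : ℝ) - P.real {w | b s w = 0})) ^ 2) P ∧
    ∫ w, (∑ s, u s * (1 - ((b s w : ℕ) : ℝ) - P.real {w | b s w = 0})) ^ 2 ∂P
      = ∑ s, u s ^ 2 * (P.real {w | b s w = 0} * (1 - P.real {w | b s w = 0})) := by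
  have hm : ∀ s, MeasurableSet {w | b s w = 0} := fun s => hb s (measurableSet_singleton 0)
  have hL0 : ∀ s, MemLp (fun w => 1 - ((b s w : ℕ) : ℝ)) 2 P := by
    intro s
    rw [one_sub_bit_eq_indicator]
    exact memLp_indicator_const 2 (hm s) 1 (Or.inr (measure_ne_top P _))
  have hL : ∀ s, MemLp (fun w => u s * (1 - ((b s w : ℕ) : ℝ))) 2 P :=
    fun s => (hL0 s).const_mul (u s)
  have hexp : ∀ s, ∫ w, u s * (1 - ((b s w : ℕ) : ℝ)) ∂P = u s * P.real {w | b s w = 0} := by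
    intro s
    rw [integral_const_mul, one_sub_bit_eq_indicator, integral_indicator_one (hm s)]
  have hsum : MemLp (fun w => ∑ s, u s * (1 - ((b s w : ℕ) : ℝ))) 2 P :=
    memLp_finsetSum Finset.univ fun s _ => hL s
  have hmean : ∫ w, ∑ s, u s * (1 - ((b s w : ℕ) : ℝ)) ∂P
      = ∑ s, u s * P.real {w | b s w = 0} := by
    rw [integral_finsetSum _ fun s _ => (hL s).integrable (by norm_num)]
    exact Finset.sum_congr rfl fun s _ => hexp s
  have hcenter : (fun w => (∑ s, u s * (1 - ((b s w : ℕ) : ℝ) - P.real {w | b s w = 0})) ^ 2)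
      = fun w => ((∑ s, u s * (1 - ((b s w : ℕ) : ℝ)))
        - ∑ s, u s * P.real {w | b s w = 0}) ^ 2 := by
    funext w
    rw [← Finset.sum_sub_distrib]
    simp only [mul_sub]
  constructor
  · rw [hcenter]
    exact (hsum.sub (memLp_const _)).integrable_sq
  · have hvar : Var[∑ s, fun w => u s * (1 - ((b s w : ℕ) : ℝ)); P]
        = ∑ s, Var[fun w => u s * (1 - ((b s w : ℕ) : ℝ)); P] := by
      refine IndepFun.variance_sum (fun s _ => hL s) fun s _ t _ hst => ?_
      exact (hi.indepFun hst).comp (φ := fun x : Fin 2 => u s * (1 - ((x : ℕ) : ℝ)))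
        (ψ := fun x : Fin 2 => u t * (1 - ((x : ℕ) : ℝ)))
        (measurable_of_finite _) (measurable_of_finite _)
    have hfun : (∑ s, fun w => u s * (1 - ((b s w : ℕ) : ℝ)))
        = fun w => ∑ s, u s * (1 - ((b s w : ℕ) : ℝ)) := by
      funext w
      simp
    rw [hfun, variance_eq_integral hsum.aestronglyMeasurable.aemeasurable, hmean] at hvar
    rw [hcenter, hvar]
    refine Finset.sum_congr rfl fun s _ => ?_
    rw [variance_const_mul, variance_one_sub_bit (hb s)]

/-- The mean square of a complex linear combination of centered independent bits. -/
theorem integrable_and_integral_norm_sq_sum_bits [IsProbabilityMeasure P] {ι : Type*} [Fintype ι]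
    {b : ι → Ω → Fin 2} (hb : ∀ s, Measurable (b s)) (hi : iIndepFun b P) (u : ι → ℂ) :
    Integrable (fun w => ‖∑ s, u s *
      ((1 - ((b s w : ℕ) : ℝ) - P.real {w | b s w = 0} : ℝ) : ℂ)‖ ^ 2) P ∧
    ∫ w, ‖∑ s, u s * ((1 - ((b s w : ℕ) : ℝ) - P.real {w | b s w = 0} : ℝ) : ℂ)‖ ^ 2 ∂P
      = ∑ s, ‖u s‖ ^ 2 * (P.real {w | b s w = 0} * (1 - P.real {w | b s w = 0})) := by
  obtain ⟨hre, hre'⟩ := integrable_and_integral_sq_sum_bits hb hi fun s => (u s).re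
  obtain ⟨him, him'⟩ := integrable_and_integral_sq_sum_bits hb hi fun s => (u s).im
  have hsplit : (fun w => ‖∑ s, u s *
      ((1 - ((b s w : ℕ) : ℝ) - P.real {w | b s w = 0} : ℝ) : ℂ)‖ ^ 2)
      = fun w => (∑ s, (u s).re * (1 - ((b s w : ℕ) : ℝ) - P.real {w | b s w = 0})) ^ 2
        + (∑ s, (u s).im * (1 - ((b s w : ℕ) : ℝ) - P.real {w | b s w = 0})) ^ 2 := by
    funext w
    rw [← Complex.normSq_eq_norm_sq, Complex.normSq_apply, Complex.re_sum, Complex.im_sum]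
    simp only [Complex.re_mul_ofReal, Complex.im_mul_ofReal]
    ring
  rw [hsplit]
  refine ⟨hre.add him, ?_⟩
  rw [integral_add hre him, hre', him', ← Finset.sum_add_distrib]
  refine Finset.sum_congr rfl fun s _ => ?_
  rw [← Complex.normSq_eq_norm_sq, Complex.normSq_apply]
  ring

instance : Fintype Experiment :=
  ⟨⟨{.X, .Y}, by simp⟩, by intro e; cases e <;> simp⟩

theorem Experiment.sum_univ {α : Type*} [AddCommMonoid α] (f : Experiment → α) :
    ∑ e, f e = f .X + f .Y := by
  change Multiset.sum (Multiset.map f {.X, .Y}) = _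
  simp

/-- The coefficient of a single measurement outcome in `samplingError`. -/
noncomputable def shotWeight (d M k : ℕ) (s : Shot d M) : ℂ :=
  (1 / (2 * (d : ℂ) - 1)) *
    Complex.exp (-(2 * Real.pi * Complex.I * ((s.2.1 : ℕ) : ℂ) * ((k : ℤ) : ℂ)
      / (2 * (d : ℂ) - 1))) * ((match s.1 with | .X => 1 | .Y => Complex.I) * (1 / (M : ℂ)))

theorem norm_shotWeight {d M : ℕ} (hd : 1 ≤ d) (k : ℕ) (s : Shot d M) :
    ‖shotWeight d M k s‖ = 1 / ((2 * (d : ℝ) - 1) * M) := by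
  have hd1 : (1 : ℝ) ≤ d := by exact_mod_cast hd
  have h1 : ‖Complex.exp (-(2 * Real.pi * Complex.I * ((s.2.1 : ℕ) : ℂ) * ((k : ℤ) : ℂ)
      / (2 * (d : ℂ) - 1)))‖ = 1 := by
    have : -(2 * Real.pi * Complex.I * ((s.2.1 : ℕ) : ℂ) * ((k : ℤ) : ℂ) / (2 * (d : ℂ) - 1))
        = ((-(2 * Real.pi * (s.2.1 : ℕ) * k / (2 * d - 1)) : ℝ) : ℂ) * Complex.I := by
      push_cast
      ring
    rw [this, Complex.norm_exp_ofReal_mul_I]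
  have h2 : ‖(match s.1 with | .X => 1 | .Y => Complex.I : ℂ)‖ = 1 := by
    cases s.1 <;> simp
  have h3 : ‖2 * (d : ℂ) - 1‖ = 2 * (d : ℝ) - 1 := by
    have : 2 * (d : ℂ) - 1 = ((2 * (d : ℝ) - 1 : ℝ) : ℂ) := by
      push_cast
      ring
    rw [this, Complex.norm_real, Real.norm_of_nonneg (by linarith)]
  rw [shotWeight]
  simp only [norm_mul, norm_div, h1, h2, h3, norm_one, Complex.norm_natCast]
  rw [mul_one, one_mul, div_mul_div_comm, one_mul]

theorem samplingError_eq_sum {d M : ℕ} (hd : 1 ≤ d) (hM : 1 ≤ M) {θ φ χ : ℝ}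
    (hc : Real.cos θ ≠ 0) {b : Shot d M → Ω → Fin 2}
    (hb : IsMeasurementRecord P d M θ φ χ b) {k : ℕ} (hk : k < d) (w : Ω) :
    samplingError θ φ χ b k w = ∑ s, shotWeight d M k s *
      ((1 - ((b s w : ℕ) : ℝ) - P.real {w | b s w = 0} : ℝ) : ℂ) := by
  have hM0 : (M : ℂ) ≠ 0 := by
    have : M ≠ 0 := by omega
    exact_mod_cast this
  have hfreq : ∀ e j, ((probExp b e j w - prob e d θ φ χ (samplingAngle d j) : ℝ) : ℂ)
      = ∑ i : Fin M, (1 / (M : ℂ))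
        * ((1 - ((b (e, j, i) w : ℕ) : ℝ) - P.real {w | b (e, j, i) w = 0} : ℝ) : ℂ) := by
    intro e j
    simp only [hb.prob_zero, probExp]
    rw [← Finset.mul_sum]
    push_cast
    simp only [Finset.sum_sub_distrib, Finset.sum_const, Finset.card_univ, Fintype.card_fin,
      nsmul_eq_mul]
    field_simp
  rw [samplingError, ← sum_exp_mul_reconstructed hd θ φ χ hc hk, fourierCoefficientExp, ← mul_sub,
    ← Finset.sum_sub_distrib, Fintype.sum_prod_type, Experiment.sum_univ]
  simp only [Fintype.sum_prod_type]
  rw [← Finset.sum_add_distrib, Finset.mul_sum]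
  refine Finset.sum_congr rfl fun j _ => ?_
  have hX := hfreq .X j
  have hY := hfreq .Y j
  have hX' : ∑ i : Fin M, shotWeight d M k (.X, j, i)
      * ((1 - ((b (.X, j, i) w : ℕ) : ℝ) - P.real {w | b (.X, j, i) w = 0} : ℝ) : ℂ)
      = (1 / (2 * (d : ℂ) - 1)) * Complex.exp (-(2 * Real.pi * Complex.I * ((j : ℕ) : ℂ)
        * ((k : ℤ) : ℂ) / (2 * (d : ℂ) - 1)))
        * ((probExp b .X j w - prob .X d θ φ χ (samplingAngle d j) : ℝ) : ℂ) := by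
    rw [hX, Finset.mul_sum]
    refine Finset.sum_congr rfl fun i _ => ?_
    simp only [shotWeight]
    ring
  have hY' : ∑ i : Fin M, shotWeight d M k (.Y, j, i)
      * ((1 - ((b (.Y, j, i) w : ℕ) : ℝ) - P.real {w | b (.Y, j, i) w = 0} : ℝ) : ℂ)
      = (1 / (2 * (d : ℂ) - 1)) * Complex.exp (-(2 * Real.pi * Complex.I * ((j : ℕ) : ℂ)
        * ((k : ℤ) : ℂ) / (2 * (d : ℂ) - 1))) * Complex.I
        * ((probExp b .Y j w - prob .Y d θ φ χ (samplingAngle d j) : ℝ) : ℂ) := by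
    rw [hY, Finset.mul_sum]
    refine Finset.sum_congr rfl fun i _ => ?_
    simp only [shotWeight]
    ring
  rw [hX', hY', reconstructedExp, reconstructed]
  push_cast
  ring

/-- The sampling error has a finite second moment between `0` (exclusive) and `1/(2(2d-1)M)`; the
upper bound is `p(1-p) ≤ 1/4`, summed over the shots. -/
theorem samplingError_secondMoment [IsProbabilityMeasure P] {d M : ℕ} (hd : 1 ≤ d) (hM : 1 ≤ M)
    {θ φ χ : ℝ} (hc : Real.cos θ ≠ 0) {b : Shot d M → Ω → Fin 2}
    (hb : IsMeasurementRecord P d M θ φ χ b) {k : ℕ} (hk : k < d) :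
    Integrable (fun w => ‖samplingError θ φ χ b k w‖ ^ 2) P ∧
    0 < ∫ w, ‖samplingError θ φ χ b k w‖ ^ 2 ∂P ∧
    ∫ w, ‖samplingError θ φ χ b k w‖ ^ 2 ∂P ≤ 1 / (2 * (2 * (d : ℝ) - 1) * M) := by
  have hd1 : (1 : ℝ) ≤ d := by exact_mod_cast hd
  have hM1 : (1 : ℝ) ≤ M := by exact_mod_cast hM
  have hNM : 0 < (2 * (d : ℝ) - 1) * M := mul_pos (by linarith) (by linarith)
  obtain ⟨h1, h2⟩ := integrable_and_integral_norm_sq_sum_bits hb.measurable hb.indep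
    (shotWeight d M k)
  simp only [← samplingError_eq_sum hd hM hc hb hk] at h1 h2
  have hp : ∀ s, 0 ≤ P.real {w | b s w = 0} * (1 - P.real {w | b s w = 0}) := fun s =>
    mul_nonneg measureReal_nonneg (by linarith [measureReal_le_one (μ := P) (s := {w | b s w = 0})])
  refine ⟨h1, ?_, ?_⟩
  · rw [h2]
    simp only [norm_shotWeight hd]
    -- Not both experiments at the same angle are deterministic, since `|h| ≤ 1/2`.
    let j₀ : Fin (2 * d - 1) := ⟨0, by omega⟩
    let i₀ : Fin M := ⟨0, by omega⟩
    have hh := norm_sq_reconstructed_le d θ φ χ (samplingAngle d j₀)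
    rw [← Complex.normSq_eq_norm_sq, Complex.normSq_apply] at hh
    simp [reconstructed] at hh
    have hpos : 0 < ((1 / ((2 * (d : ℝ) - 1) * M)) ^ 2) := by positivity
    have hex : ∃ e : Experiment, 0 < P.real {w | b (e, j₀, i₀) w = 0}
        * (1 - P.real {w | b (e, j₀, i₀) w = 0}) := by
      by_contra! hcon
      have hX := hcon .X
      have hY := hcon .Y
      rw [hb.prob_zero] at hX hY
      nlinarith
    obtain ⟨e, he⟩ := hex
    exact Finset.sum_pos' (fun s _ => mul_nonneg hpos.le (hp s))
      ⟨(e, j₀, i₀), Finset.mem_univ _, mul_pos hpos he⟩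
  · rw [h2]
    simp only [norm_shotWeight hd]
    have hcard : (Fintype.card (Shot d M) : ℝ) = 2 * ((2 * (d : ℝ) - 1) * M) := by
      have he : Fintype.card Experiment = 2 := rfl
      rw [Fintype.card_prod, Fintype.card_prod, he, Fintype.card_fin, Fintype.card_fin]
      rw [Nat.cast_mul, Nat.cast_mul, Nat.cast_sub (by omega)]
      push_cast
      ring
    calc _ ≤ ∑ _s : Shot d M, (1 / ((2 * (d : ℝ) - 1) * M)) ^ 2 * (1 / 4) := by
          refine Finset.sum_le_sum fun s _ => ?_
          refine mul_le_mul_of_nonneg_left ?_ (sq_nonneg _)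
          nlinarith [sq_nonneg (P.real {w | b s w = 0} - 1 / 2)]
      _ = _ := by
          rw [Finset.sum_const, Finset.card_univ, nsmul_eq_mul, hcard, mul_assoc 2 _ (M : ℝ)]
          field_simp
          norm_num

end Noise

end QSPC

theorem theorem2 {Ω : Type*} [MeasurableSpace Ω] (P : Measure Ω) [IsProbabilityMeasure P]
    (d M : ℕ) (hd : 1 ≤ d) (hM : 1 ≤ M) (θ φ χ : ℝ)
    (hθ : (d : ℝ) ^ (5 / 4 : ℝ) * |θ| < 1)
    (b : QSPC.Shot d M → Ω → Fin 2) (hb : QSPC.IsMeasurementRecord P d M θ φ χ b)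
    (k : ℕ) (hk : k < d) :
    Integrable (fun w => ‖QSPC.samplingError θ φ χ b k w‖ ^ 2) P ∧
    0 < ∫ w, ‖QSPC.samplingError θ φ χ b k w‖ ^ 2 ∂P ∧
    2 * (2 * (d : ℝ) - 1) * M * Real.sin θ ^ 2 *
        (1 - 4 / 3 * ((d : ℝ) * θ) ^ 2 * (1 + 3 * (d : ℝ) ^ 3 * θ ^ 2)) ≤
      QSPC.SNR P θ φ χ b k := by
  have hd1 : (1 : ℝ) ≤ d := by exact_mod_cast hd
  have hM1 : (1 : ℝ) ≤ M := by exact_mod_cast hM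
  have hθ4 : (d : ℝ) ^ 5 * θ ^ 4 < 1 := by
    have h1 : ((d : ℝ) ^ (5 / 4 : ℝ) * |θ|) ^ 4 < 1 := pow_lt_one₀ (by positivity) hθ (by norm_num)
    rw [mul_pow, (by decide : Even 4).pow_abs, ← Real.rpow_natCast, ← Real.rpow_mul (by positivity)]
      at h1
    norm_num at h1
    exact h1
  have hθ1 : |θ| < 1 := by
    have : 1 ≤ (d : ℝ) ^ (5 / 4 : ℝ) := Real.one_le_rpow hd1 (by norm_num)
    nlinarith [abs_nonneg θ]
  have hcos := QSPC.cos_pos_of_abs_lt_one hθ1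
  obtain ⟨hint, hpos, hle⟩ := QSPC.samplingError_secondMoment hd hM hcos.ne' hb hk
  refine ⟨hint, hpos, ?_⟩
  have hsig := QSPC.norm_sq_fourierCoefficient_ge hd φ χ hcos hθ4 hk
  have hNM : 0 < 2 * (2 * (d : ℝ) - 1) * M := mul_pos (by linarith) (by linarith)
  rw [QSPC.SNR, le_div_iff₀ hpos]
  have hnoise : 2 * (2 * (d : ℝ) - 1) * M * ∫ w, ‖QSPC.samplingError θ φ χ b k w‖ ^ 2 ∂P ≤ 1 := by
    rwa [le_div_iff₀' hNM] at hle
  have hnoise0 := mul_pos hNM hpos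
  have hc2 := sq_nonneg ‖QSPC.fourierCoefficient d θ φ χ k‖
  nlinarith [mul_le_mul_of_nonneg_left hsig hnoise0.le, mul_le_mul_of_nonneg_right hnoise hc2]
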